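/- For a finite group $G$ and $x\in G$, the subnormalizer of $x$ in $G$ is the subgroup $$\mathbf{Sub}_G(x)=\langle\, g\in G \mid \langle x\rangle \text{ is subnormal in } \langle x,g\rangle \,\rangle .$$ For $\Omega\subseteq\{1,\dots,n\}$ write $\mathsf S_\Omega=\operatorname{Sym}(\Omega)$ and $\overline\Omega=\{1,\dots,n\}\setminus\Omega$, and regard $\mathsf S_\Omega\times\mathsf S_{\overline\Omega}$ as a subgroup of $\mathsf S_n$. **Theorem.** Let $n$ be a non-negative integer that is not a power of $2$ (where $1=2^0$ counts as a power of $2$), and let $x\in\mathsf S_n$ be a $2$-element. Let the distinct lengths of the cycles of $x$ (fixed points being counted as cycles of length $1$) be $2^{m_1},\dots,2^{m_r}$ with $0\le m_1<m_2<\dots<m_r$, and suppose that $x$ has exactly $\ell_i\ge 1$ cycles of length $2^{m_i}$ for $1\le i\le r$. Then $\mathbf{Sub}_{\mathsf S_n}(x)<\mathsf S_n$ if and only if there exists $t$ with $2\le t\le r$ such that $$2^{m_t}>\sum_{i=1}^{t-1}\ell_i2^{m_i}.$$ Moreover, for every such $t$, let $y$ be the product of all cycles of $x$ of length at least $2^{m_t}$,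 let $z$ be the product of all cycles of $x$ of length smaller than $2^{m_t}$, and let $\Omega$ be the support of $y$ (the set of points moved by $y$). Then $|\Omega|=k:=\sum_{i=t}^{r}\ell_i2^{m_i}$, so that $\mathsf S_\Omega\cong\mathsf S_k$ and $\mathsf S_{\overline\Omega}\cong\mathsf S_{n-k}$, and $$\mathbf{Sub}_{\mathsf S_n}(x)=\mathbf{Sub}_{\mathsf S_\Omega}(y)\times\mathbf{Sub}_{\mathsf S_{\overline\Omega}}(z).$$ -/

import Mathlib

/-- The subnormalizer of `x` in `G`: the subgroup generated by all `g` such that `⟨x⟩` is subnormal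
in `⟨x, g⟩`. -/
def subnormalizer {G : Type*} [Group G] (x : G) : Subgroup G :=
  Subgroup.closure
    {g : G | ((Subgroup.zpowers x).subgroupOf (Subgroup.closure {x, g})).IsSubnormal}

namespace Equiv.Perm

variable {α : Type*} [DecidableEq α] [Fintype α]

/-- The product of all cycles of length at least `L` in the disjoint cycle decomposition of `x`.
(Cycles of length one are the identity and do not contribute.) -/
def longPart (x : Perm α) (L : ℕ) : Perm α :=
  (x.cycleFactorsFinset.filter fun c => L ≤ c.support.card).noncommProd id fun _ ha _ hb h =>
    x.cycleFactorsFinset_mem_commute (Finset.mem_filter.mp ha).1 (Finset.mem_filter.mp hb).1 h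

/-- The product of all cycles of length smaller than `L` in the disjoint cycle decomposition
of `x`. -/
def shortPart (x : Perm α) (L : ℕ) : Perm α :=
  (x.cycleFactorsFinset.filter fun c => c.support.card < L).noncommProd id fun _ ha _ hb h =>
    x.cycleFactorsFinset_mem_commute (Finset.mem_filter.mp ha).1 (Finset.mem_filter.mp hb).1 h

theorem disjoint_longPart_shortPart (x : Perm α) (L : ℕ) :
    (x.longPart L).Disjoint (x.shortPart L) := by
  unfold longPart shortPart
  apply disjoint_noncommProd_right
  intro c hc
  apply Disjoint.symm
  apply disjoint_noncommProd_right
  intro d hd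
  rw [Finset.mem_filter] at hc hd
  refine x.cycleFactorsFinset_pairwise_disjoint hc.1 hd.1 ?_
  rintro rfl
  exact absurd hc.2 (not_lt.mpr hd.2)

theorem shortPart_apply_notMem_support_longPart_iff (x : Perm α) (L : ℕ) (a : α) :
    x.shortPart L a ∉ (x.longPart L).support ↔ a ∉ (x.longPart L).support := by
  have h := x.disjoint_longPart_shortPart L
  have hc : x.longPart L (x.shortPart L a) = x.shortPart L (x.longPart L a) :=
    congrArg (fun σ : Perm α => σ a) h.commute.eq
  rw [notMem_support, notMem_support, hc, (x.shortPart L).injective.eq_iff]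

/-- The long-cycle part `y` of `x`, as an element of `Sym(Ω)`, where `Ω` is the support of `y`. -/
def longPartOnSupport (x : Perm α) (L : ℕ) : Perm {a // a ∈ (x.longPart L).support} :=
  (x.longPart L).subtypePerm fun _ => apply_mem_support

/-- The short-cycle part of `x`, as an element of the symmetric group on the complement of the
support of the long-cycle part of `x`. -/
def shortPartOnCompl (x : Perm α) (L : ℕ) : Perm {a // a ∉ (x.longPart L).support} :=
  (x.shortPart L).subtypePerm (x.shortPart_apply_notMem_support_longPart_iff L)

end Equiv.Perm

/-!
Since `O_p(⟨x, g⟩)` contains every subnormal `p`-subgroup of `⟨x, g⟩`, the subnormalizer of a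
`p`-element `x` is generated by the normalizers of the `p`-subgroups containing `x`.

Suppose fewer than `p ^ m` points lie on cycles of `x` of length less than `p ^ m`. Let `Q` be a
`p`-subgroup containing `x`. A `Q`-orbit with at least `p ^ m` points has size divisible by `p ^ m`,
and so has its set of points on long cycles; the rest of the orbit is too small to be nonempty.
The points on long cycles are therefore those in long `Q`-orbits, a set which the normalizer of `Q`
preserves. So the subnormalizer lies in a product of two symmetric groups, where it splits.

Conversely, let `p = 2` and suppose that the points on cycles shorter than a given cycle of `x` are
never that few, unless there are none. By the Frattini argument for a normal subgroup containing
`x`, the subnormalizer realizes every permutation of a family of `x`-invariant sets which is induced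
by the symmetric group; in particular it exchanges disjoint invariant sets of equal size. It also
contains `(a b)` for `a`, `b` on different cycles of equal length, as the conjugates of `(a b)`
under the powers of `x` commute. Adding the cycles in increasing order of length, one obtains all
transpositions on the points of cycle length less than `2 ^ k`, unless the number of these points is
a power of two at most `2 ^ k`; for large `k` that number is `n`.
-/

section PCore

variable {G K : Type*} [Group G] [Group K] {p : ℕ}

/-- The `p`-core of `G`, i.e. the largest normal `p`-subgroup, usually written `O_p(G)`. -/
def pCore (p : ℕ) (G : Type*) [Group G] : Subgroup G :=
  sSup {M | M.Normal ∧ IsPGroup p M}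

theorem le_pCore {M : Subgroup G} (hM : M.Normal) (hp : IsPGroup p M) : M ≤ pCore p G :=
  le_sSup ⟨hM, hp⟩

theorem isPGroup_pCore (p : ℕ) (G : Type*) [Group G] : IsPGroup p (pCore p G) :=
  Sylow.sSup_of_normal _ (fun _ hM => hM.2) fun _ hM => hM.1

theorem map_pCore_le_of_surjective {f : G →* K} (hf : Function.Surjective f) :
    (pCore p G).map f ≤ pCore p K := by
  rw [Subgroup.map_le_iff_le_comap]
  refine sSup_le fun M hM => ?_
  rw [← Subgroup.map_le_iff_le_comap]
  exact le_pCore (hM.1.map f hf) (hM.2.map f)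

instance pCore_characteristic : (pCore p G).Characteristic :=
  Subgroup.characteristic_iff_map_le.mpr fun φ => map_pCore_le_of_surjective φ.surjective

theorem map_pCore_le_of_normal_range {f : G →* K} (hf : f.range.Normal) :
    (pCore p G).map f ≤ pCore p K := by
  have hle : (pCore p G).map f ≤ (pCore p f.range).map f.range.subtype := by
    rw [← f.subtype_comp_rangeRestrict, ← Subgroup.map_map]
    exact Subgroup.map_mono (map_pCore_le_of_surjective f.rangeRestrict_surjective)
  exact hle.trans (le_pCore inferInstance ((isPGroup_pCore p f.range).map _))

theorem map_subtype_pCore_le_of_isSubnormal {H : Subgroup G} (hH : H.IsSubnormal) :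
    (pCore p H).map H.subtype ≤ pCore p G := by
  induction hH with
  | top => exact map_pCore_le_of_surjective fun g => ⟨⟨g, trivial⟩, rfl⟩
  | step H K hle _ hN ih =>
    have hrange : (Subgroup.inclusion hle).range.Normal := by rwa [Subgroup.inclusion_range]
    calc (pCore p H).map H.subtype
        = ((pCore p H).map (Subgroup.inclusion hle)).map K.subtype := by
          rw [Subgroup.map_map, Subgroup.subtype_comp_inclusion]
      _ ≤ (pCore p K).map K.subtype := Subgroup.map_mono (map_pCore_le_of_normal_range hrange)
      _ ≤ pCore p G := ih

theorem le_pCore_of_isSubnormal {H : Subgroup G} (hH : H.IsSubnormal) (hp : IsPGroup p H) :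
    H ≤ pCore p G := by
  have htop : (⊤ : Subgroup H) ≤ pCore p H := le_pCore inferInstance (hp.to_subgroup ⊤)
  calc H = (⊤ : Subgroup H).map H.subtype := by rw [← MonoidHom.range_eq_map, H.range_subtype]
    _ ≤ (pCore p H).map H.subtype := Subgroup.map_mono htop
    _ ≤ pCore p G := map_subtype_pCore_le_of_isSubnormal hH

end PCore

section Subnormalizer

variable {G : Type*} [Group G] {p : ℕ}

theorem isPGroup_closure_of_commute {S : Set G}
    (hcomm : ∀ s ∈ S, ∀ t ∈ S, Commute s t) (hS : ∀ s ∈ S, ∃ k, s ^ p ^ k = 1) :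
    IsPGroup p (Subgroup.closure S) := by
  have := Subgroup.isMulCommutative_closure hcomm
  rintro ⟨g, hg⟩
  suffices ∃ k, g ^ p ^ k = 1 by simpa [Subtype.ext_iff] using this
  induction hg using Subgroup.closure_induction with
  | mem s hs => exact hS s hs
  | one => exact ⟨0, one_pow _⟩
  | inv s _ ih => exact ih.imp fun k hk => by rw [inv_pow, hk, inv_one]
  | mul s t hs ht ihs iht =>
    obtain ⟨i, hi⟩ := ihs
    obtain ⟨j, hj⟩ := iht
    have hst : Commute s t := setLike_mul_comm hs ht
    exact ⟨i + j, by rw [hst.mul_pow, pow_add, pow_mul, hi, one_pow, mul_comm, pow_mul, hj, one_pow,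
      one_mul]⟩

variable [Finite G]

theorem isSubnormal_of_normalizerCondition (h : NormalizerCondition G)
    (H : Subgroup G) : H.IsSubnormal := by
  induction H using WellFoundedGT.induction with
  | ind H ih =>
    rcases eq_or_ne H ⊤ with rfl | hne
    · exact .top
    · exact .step H _ Subgroup.le_normalizer (ih _ (h H hne.lt_top))
        Subgroup.normal_in_normalizer

variable [Fact p.Prime] {x : G}

theorem isSubnormal_of_le_normal_isPGroup {H N : Subgroup G} (hN : N.Normal) (hp : IsPGroup p N)
    (hle : H ≤ N) : H.IsSubnormal :=
  have := hp.isNilpotent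
  .trans hle (isSubnormal_of_normalizerCondition Group.normalizerCondition_of_isNilpotent _)
    hN.isSubnormal

theorem isSubnormal_zpowers_iff_exists_isPGroup (hx : IsPGroup p (Subgroup.zpowers x)) (g : G) :
    ((Subgroup.zpowers x).subgroupOf (Subgroup.closure {x, g})).IsSubnormal ↔
      ∃ Q : Subgroup G, IsPGroup p Q ∧ x ∈ Q ∧ g ∈ Subgroup.normalizer (Q : Set G) := by
  have hxH : x ∈ Subgroup.closure {x, g} := Subgroup.subset_closure (by simp)
  have hgH : g ∈ Subgroup.closure {x, g} := Subgroup.subset_closure (by simp)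
  constructor
  · intro h
    have hle := le_pCore_of_isSubnormal h (hx.comap_of_injective _ (Subgroup.subtype_injective _))
    refine ⟨(pCore p _).map (Subgroup.subtype _), (isPGroup_pCore p _).map _,
      ⟨⟨x, hxH⟩, hle (Subgroup.mem_zpowers x), rfl⟩,
      Subgroup.le_normalizer_map _ ⟨⟨g, hgH⟩, ?_, rfl⟩⟩
    rw [Subgroup.normalizer_eq_top]
    trivial
  · rintro ⟨Q, hQ, hxQ, hgQ⟩
    have hle : Subgroup.closure {x, g} ≤ Subgroup.normalizer (Q : Set G) := by
      rw [Subgroup.closure_le, Set.insert_subset_iff, Set.singleton_subset_iff]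
      exact ⟨Subgroup.le_normalizer hxQ, hgQ⟩
    exact isSubnormal_of_le_normal_isPGroup (p := p) (N := Q.subgroupOf _)
      (Subgroup.normal_subgroupOf_of_le_normalizer hle)
      (hQ.comap_of_injective _ (Subgroup.subtype_injective _))
      (Subgroup.comap_mono (by simpa using hxQ))

theorem normalizer_le_subnormalizer {Q : Subgroup G} (hQ : IsPGroup p Q) (hx : x ∈ Q) :
    Subgroup.normalizer (Q : Set G) ≤ subnormalizer x := fun g hg =>
  Subgroup.subset_closure <| (isSubnormal_zpowers_iff_exists_isPGroup
    (hQ.to_le (Subgroup.zpowers_le.mpr hx)) g).mpr ⟨Q, hQ, hx, hg⟩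

theorem le_subnormalizer {Q : Subgroup G} (hQ : IsPGroup p Q) (hx : x ∈ Q) :
    Q ≤ subnormalizer x :=
  Subgroup.le_normalizer.trans (normalizer_le_subnormalizer hQ hx)

theorem subnormalizer_le (hx : IsPGroup p (Subgroup.zpowers x)) {H : Subgroup G}
    (hH : ∀ Q : Subgroup G, IsPGroup p Q → x ∈ Q → Subgroup.normalizer (Q : Set G) ≤ H) :
    subnormalizer x ≤ H := by
  refine (Subgroup.closure_le H).mpr fun g hg => ?_
  obtain ⟨Q, hQ, hxQ, hgQ⟩ := (isSubnormal_zpowers_iff_exists_isPGroup hx g).mp hg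
  exact hH Q hQ hxQ hgQ

theorem mem_subnormalizer_of_commute_conj {g : G} {k : ℕ} (hx : IsPGroup p (Subgroup.zpowers x))
    (hg : g ^ p ^ k = 1) (hcomm : ∀ i : ℤ, Commute g (x ^ i * g * (x ^ i)⁻¹)) :
    g ∈ subnormalizer x := by
  let S : Set G := Set.range fun i : ℤ => x ^ i * g * (x ^ i)⁻¹
  have hSp : IsPGroup p (Subgroup.closure S) := by
    refine isPGroup_closure_of_commute ?_ ?_
    · rintro _ ⟨i, rfl⟩ _ ⟨j, rfl⟩
      have hconj := (hcomm (j - i)).map (MulAut.conj (x ^ i))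
      have hji : x ^ j = x ^ i * x ^ (j - i) := by rw [← zpow_add, add_sub_cancel]
      simpa only [hji, MulAut.conj_apply, mul_inv_rev, mul_assoc] using hconj
    · rintro _ ⟨i, rfl⟩
      exact ⟨k, by rw [conj_pow, hg, mul_one, mul_inv_cancel]⟩
  have hnorm : Subgroup.zpowers x ≤ Subgroup.normalizer (Subgroup.closure S : Set G) := by
    rw [Subgroup.le_normalizer_closure_iff]
    rintro _ ⟨j, rfl⟩ _ ⟨i, rfl⟩
    exact Subgroup.subset_closure ⟨j + i, by group⟩
  have hgS : g ∈ Subgroup.closure S := Subgroup.subset_closure ⟨0, by simp⟩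
  exact le_subnormalizer (hx.to_sup_of_normal_right' hSp hnorm)
    (Subgroup.mem_sup_left (Subgroup.mem_zpowers x)) (Subgroup.mem_sup_right hgS)

theorem subnormalizer_sup_eq_top {K : Subgroup G} [K.Normal]
    (hx : IsPGroup p (Subgroup.zpowers x)) (hxK : x ∈ K) : subnormalizer x ⊔ K = ⊤ := by
  obtain ⟨P, hP⟩ := (hx.comap_subtype (K := K)).exists_le_sylow
  have hxP : x ∈ (P : Subgroup K).map K.subtype :=
    ⟨⟨x, hxK⟩, hP (Subgroup.mem_zpowers x), rfl⟩
  rw [← top_le_iff, ← P.normalizer_sup_eq_top]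
  exact sup_le_sup_right (normalizer_le_subnormalizer (P.isPGroup'.map K.subtype) hxP) K

end Subnormalizer

section Homs

variable {G H : Type*} [Group G] [Group H]

theorem normalizer_prod_le (Q : Subgroup G) (R : Subgroup H) :
    (Subgroup.normalizer (Q : Set G)).prod (Subgroup.normalizer (R : Set H)) ≤
      Subgroup.normalizer (Q.prod R : Set (G × H)) := fun _ hg =>
  Subgroup.mem_normalizer_iff.mpr fun h =>
    and_congr (Subgroup.mem_normalizer_iff.mp hg.1 h.1) (Subgroup.mem_normalizer_iff.mp hg.2 h.2)

variable [Finite G] [Finite H] {p : ℕ} [Fact p.Prime]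

theorem map_subnormalizer_le (φ : G →* H) {x : G} (hx : IsPGroup p (Subgroup.zpowers x)) :
    (subnormalizer x).map φ ≤ subnormalizer (φ x) :=
  Subgroup.map_le_iff_le_comap.mpr <| subnormalizer_le hx fun _ hQ hxQ =>
    Subgroup.map_le_iff_le_comap.mp <| (Subgroup.le_normalizer_map φ).trans <|
      normalizer_le_subnormalizer (hQ.map φ) (Subgroup.mem_map_of_mem φ hxQ)

theorem exists_mem_subnormalizer_mul_eq {K : Subgroup G} {x g : G}
    (hx : IsPGroup p (Subgroup.zpowers x)) (hxK : x ∈ K)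
    (hg : g ∈ Subgroup.normalizer (K : Set G)) : ∃ h ∈ subnormalizer x, ∃ k ∈ K, h * k = g := by
  let N := Subgroup.normalizer (K : Set G)
  let x' : N := ⟨x, Subgroup.le_normalizer hxK⟩
  have hx' : IsPGroup p (Subgroup.zpowers x') :=
    (hx.comap_subtype (K := N)).to_le (Subgroup.zpowers_le.mpr (Subgroup.mem_zpowers x))
  have htop : (⟨g, hg⟩ : N) ∈ subnormalizer x' ⊔ K.subgroupOf N := by
    rw [subnormalizer_sup_eq_top hx' hxK]
    trivial
  obtain ⟨h, hh, k, hk, hhk⟩ := Subgroup.mem_sup_of_normal_right.mp htop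
  exact ⟨h, map_subnormalizer_le N.subtype hx' ⟨h, hh, rfl⟩, k, hk, congrArg Subtype.val hhk⟩

theorem isPGroup_prod {Q : Subgroup G} {R : Subgroup H} (hQ : IsPGroup p Q) (hR : IsPGroup p R) :
    IsPGroup p (Q.prod R) := by
  obtain ⟨i, hi⟩ := IsPGroup.iff_card.mp hQ
  obtain ⟨j, hj⟩ := IsPGroup.iff_card.mp hR
  refine .of_card (n := i + j) ?_
  rw [Nat.card_congr (Q.prodEquiv R).toEquiv, Nat.card_prod, hi, hj, pow_add]

theorem subnormalizer_prod {y : G} {z : H} (hy : IsPGroup p (Subgroup.zpowers y))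
    (hz : IsPGroup p (Subgroup.zpowers z)) :
    subnormalizer (y, z) = (subnormalizer y).prod (subnormalizer z) := by
  have hyz : IsPGroup p (Subgroup.zpowers (y, z)) := (isPGroup_prod hy hz).to_le <|
    Subgroup.zpowers_le.mpr ⟨Subgroup.mem_zpowers y, Subgroup.mem_zpowers z⟩
  refine le_antisymm (Subgroup.le_prod_iff.mpr ⟨map_subnormalizer_le (.fst G H) hyz,
    map_subnormalizer_le (.snd G H) hyz⟩) (Subgroup.prod_le_iff.mpr ⟨?_, ?_⟩)
  · refine Subgroup.map_le_iff_le_comap.mpr (subnormalizer_le hy fun Q hQ hyQ g hg => ?_)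
    exact normalizer_le_subnormalizer (isPGroup_prod hQ hz) ⟨hyQ, Subgroup.mem_zpowers z⟩
      (normalizer_prod_le Q _ ⟨hg, Subgroup.one_mem _⟩)
  · refine Subgroup.map_le_iff_le_comap.mpr (subnormalizer_le hz fun R hR hzR g hg => ?_)
    exact normalizer_le_subnormalizer (isPGroup_prod hy hR) ⟨Subgroup.mem_zpowers y, hzR⟩
      (normalizer_prod_le _ R ⟨Subgroup.one_mem _, hg⟩)

theorem map_subnormalizer {φ : G →* H} (hφ : Function.Injective φ) {x : G}
    (hx : IsPGroup p (Subgroup.zpowers x))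
    (hrange : ∀ Q : Subgroup H, IsPGroup p Q → φ x ∈ Q →
      Subgroup.normalizer (Q : Set H) ≤ φ.range) :
    (subnormalizer x).map φ = subnormalizer (φ x) := by
  refine le_antisymm (map_subnormalizer_le φ hx) ?_
  have hφx : IsPGroup p (Subgroup.zpowers (φ x)) := MonoidHom.map_zpowers φ x ▸ hx.map φ
  refine subnormalizer_le hφx fun Q hQ hxQ h hh => ?_
  obtain ⟨g, rfl⟩ := hrange Q hQ hxQ hh
  exact ⟨g, normalizer_le_subnormalizer (hQ.comap_of_injective φ hφ) hxQ
    (Subgroup.le_normalizer_comap φ hh), rfl⟩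

end Homs

section Orbits

open MulAction
open scoped Pointwise

variable {G α : Type*} [Group G] [MulAction G α] {Q : Subgroup G} {A B : Set α}

theorem orbit_subset_of_le_stabilizer (hA : Q ≤ stabilizer G A) {a : α} (ha : a ∈ A) :
    orbit Q a ⊆ A := by
  rintro _ ⟨q, rfl⟩
  exact (mem_stabilizer_set.mp (hA q.2) a).mpr ha

theorem le_stabilizer_orbit (Q : Subgroup G) (a : α) : Q ≤ stabilizer G (orbit Q a) := fun q hq =>
  smul_orbit (⟨q, hq⟩ : Q) a

theorem le_stabilizer_inter (hA : Q ≤ stabilizer G A) (hB : Q ≤ stabilizer G B) :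
    Q ≤ stabilizer G (A ∩ B) :=
  (le_inf hA hB).trans stabilizer_inf_stabilizer_le_stabilizer_inter

theorem le_stabilizer_union (hA : Q ≤ stabilizer G A) (hB : Q ≤ stabilizer G B) :
    Q ≤ stabilizer G (A ∪ B) :=
  (le_inf hA hB).trans stabilizer_inf_stabilizer_le_stabilizer_union

theorem le_stabilizer_sdiff (hA : Q ≤ stabilizer G A) (hB : Q ≤ stabilizer G B) :
    Q ≤ stabilizer G (A \ B) :=
  (le_inf hA hB).trans stabilizer_inf_stabilizer_le_stabilizer_sdiff

theorem orbit_smul_of_mem_normalizer {g : G} (hg : g ∈ Subgroup.normalizer (Q : Set G)) (a : α) :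
    orbit Q (g • a) = g • orbit Q a := by
  ext b
  rw [Set.mem_smul_set_iff_inv_smul_mem]
  constructor
  · rintro ⟨q, rfl⟩
    refine ⟨⟨g⁻¹ * q * g, (Subgroup.mem_normalizer_iff''.mp hg q).mp q.2⟩, ?_⟩
    simp [Subgroup.smul_def, mul_smul]
  · rintro ⟨q, hq⟩
    refine ⟨⟨g * q * g⁻¹, (Subgroup.mem_normalizer_iff.mp hg q).mp q.2⟩, ?_⟩
    rw [eq_inv_smul_iff] at hq
    simp [← hq, Subgroup.smul_def, mul_smul]

variable [Finite α]

theorem dvd_ncard_of_le_stabilizer {l : ℕ} (hA : Q ≤ stabilizer G A)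
    (hl : ∀ a ∈ A, l ∣ (orbit Q a).ncard) : l ∣ A.ncard := by
  induction A using WellFoundedLT.induction with
  | ind A ih =>
    obtain rfl | ⟨a, ha⟩ := A.eq_empty_or_nonempty
    · simp
    have hsub := orbit_subset_of_le_stabilizer hA ha
    have hlt : A \ orbit Q a < A := sdiff_lt hsub (nonempty_orbit a).ne_empty
    rw [← Set.ncard_sdiff_add_ncard_of_subset hsub]
    exact dvd_add (ih _ hlt (le_stabilizer_sdiff hA (le_stabilizer_orbit Q a))
      fun b hb => hl b hb.1) (hl a ha)

theorem pow_dvd_ncard_orbit_iff {p : ℕ} [Fact p.Prime] (hQ : IsPGroup p Q) (a : α) {m : ℕ} :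
    p ^ m ∣ (orbit Q a).ncard ↔ p ^ m ≤ (orbit Q a).ncard := by
  have hp : 1 < p := Fact.out (p := p.Prime) |>.one_lt
  obtain ⟨k, hk⟩ := hQ.card_orbit a
  rw [← Nat.card_coe_set_eq, hk, Nat.pow_dvd_pow_iff_le_right hp, Nat.pow_le_pow_iff_right hp]

theorem exists_subset_ncard_eq_of_forall_dvd {p c : ℕ} [Fact p.Prime] (hQ : IsPGroup p Q)
    (hA : Q ≤ stabilizer G A) (hdvd : ∀ a ∈ A, (orbit Q a).ncard ∣ c) (hc : c ≤ A.ncard) :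
    ∃ B ⊆ A, Q ≤ stabilizer G B ∧ B.ncard = c := by
  induction A using WellFoundedLT.induction generalizing c with
  | ind A ih =>
    obtain rfl | hpos := c.eq_zero_or_pos
    · exact ⟨∅, A.empty_subset, by simp, Set.ncard_empty α⟩
    obtain ⟨a, ha, hmax⟩ := Set.exists_max_image A (fun a => (orbit Q a).ncard) A.toFinite
      (Set.nonempty_of_ncard_ne_zero (hpos.trans_le hc).ne')
    have hsub := orbit_subset_of_le_stabilizer hA ha
    have hcard := Set.ncard_sdiff_add_ncard_of_subset hsub
    have hle := Nat.le_of_dvd hpos (hdvd a ha)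
    have hdvd' : ∀ b ∈ A \ orbit Q a, (orbit Q b).ncard ∣ c - (orbit Q a).ncard := by
      intro b hb
      obtain ⟨k, hk⟩ := hQ.card_orbit b
      rw [Nat.card_coe_set_eq] at hk
      have hba : (orbit Q b).ncard ∣ (orbit Q a).ncard := by
        rw [hk, pow_dvd_ncard_orbit_iff hQ, ← hk]
        exact hmax b hb.1
      exact Nat.dvd_sub (hdvd b hb.1) hba
    obtain ⟨B, hBA, hB, hBc⟩ := ih _ (sdiff_lt hsub (nonempty_orbit a).ne_empty)
      (le_stabilizer_sdiff hA (le_stabilizer_orbit Q a)) hdvd' (by omega)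
    refine ⟨B ∪ orbit Q a, Set.union_subset (hBA.trans Set.sdiff_subset) hsub,
      le_stabilizer_union hB (le_stabilizer_orbit Q a), ?_⟩
    rw [Set.ncard_union_eq (Set.disjoint_sdiff_left.mono_left hBA), hBc]
    omega

end Orbits

section Period

open MulAction
open scoped Pointwise

variable {G α : Type*} [Group G] [MulAction G α] {x : G} {a : α}

theorem period_zpow_smul (x : G) (i : ℤ) (a : α) : period x (x ^ i • a) = period x a :=
  Nat.dvd_right_iff_eq.mp fun k => by
    rw [← pow_smul_eq_iff_period_dvd, ← pow_smul_eq_iff_period_dvd, smul_smul,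
      ((Commute.refl x).pow_left k).zpow_right i |>.eq, mul_smul, smul_left_cancel_iff]

theorem le_stabilizer_setOf_period (x : G) (P : ℕ → Prop) :
    Subgroup.zpowers x ≤ stabilizer G {a : α | P (period x a)} := by
  rintro _ ⟨i, rfl⟩
  refine mem_stabilizer_set.mpr fun a => ?_
  rw [Set.mem_ofPred_eq, Set.mem_ofPred_eq, period_zpow_smul]

theorem orbit_zpowers_subset_setOf_period_eq {l : ℕ} (ha : period x a = l) :
    orbit (Subgroup.zpowers x) a ⊆ {b | period x b = l} :=
  orbit_subset_of_le_stabilizer (le_stabilizer_setOf_period x (· = l)) ha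

theorem disjoint_setOf_period_lt_setOf_period_eq (x : G) (l : ℕ) :
    Disjoint {a : α | period x a < l} {a | period x a = l} :=
  Set.disjoint_left.mpr fun _ hlt heq => hlt.ne heq

variable [Finite α]

theorem ncard_orbit_zpowers (x : G) (a : α) :
    (orbit (Subgroup.zpowers x) a).ncard = period x a := by
  have := Fintype.ofFinite (orbit (Subgroup.zpowers x) a)
  rw [period_eq_minimalPeriod, minimalPeriod_eq_card, ← Nat.card_eq_fintype_card,
    Nat.card_coe_set_eq]

variable {p : ℕ} [Fact p.Prime]

theorem exists_period_eq_pow (hx : IsPGroup p (Subgroup.zpowers x)) (a : α) :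
    ∃ k, period x a = p ^ k := by
  rw [← ncard_orbit_zpowers]
  exact hx.card_orbit a

theorem setOf_period_lt_pow_succ (hx : IsPGroup p (Subgroup.zpowers x)) (k : ℕ) :
    {a : α | period x a < p ^ (k + 1)} = {a | period x a < p ^ k} ∪ {a | period x a = p ^ k} := by
  have hp : 1 < p := (Fact.out : p.Prime).one_lt
  ext a
  obtain ⟨j, hj⟩ := exists_period_eq_pow hx a
  simp only [Set.mem_union, Set.mem_ofPred_eq, hj, Nat.pow_lt_pow_iff_right hp,
    Nat.pow_right_inj hp]
  omega

theorem pow_dvd_period_iff (hx : IsPGroup p (Subgroup.zpowers x)) (a : α) {m : ℕ} :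
    p ^ m ∣ period x a ↔ p ^ m ≤ period x a := by
  rw [← ncard_orbit_zpowers, pow_dvd_ncard_orbit_iff hx]

theorem orbit_subset_setOf_pow_le_period {Q : Subgroup G} (hQ : IsPGroup p Q) (hx : x ∈ Q) {m : ℕ}
    (hm : {a : α | period x a < p ^ m}.ncard < p ^ m) (ha : p ^ m ≤ (orbit Q a).ncard) :
    orbit Q a ⊆ {b | p ^ m ≤ period x b} := by
  let A : Set α := {b | p ^ m ≤ period x b}
  have hinv : Subgroup.zpowers x ≤ stabilizer G (orbit Q a ∩ A) :=
    le_stabilizer_inter ((Subgroup.zpowers_le.mpr hx).trans (le_stabilizer_orbit Q a))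
      (le_stabilizer_setOf_period x (p ^ m ≤ ·))
  -- `p ^ m` divides the size of the orbit and that of its long part, hence that of the short part,
  -- which has fewer than `p ^ m` points.
  have hinter : p ^ m ∣ (orbit Q a ∩ A).ncard := by
    refine dvd_ncard_of_le_stabilizer hinv fun b hb => ?_
    rw [ncard_orbit_zpowers, pow_dvd_period_iff (hQ.to_le (Subgroup.zpowers_le.mpr hx))]
    exact hb.2
  have hsdiff : p ^ m ∣ (orbit Q a \ A).ncard := by
    rw [← Nat.dvd_add_right hinter, Set.ncard_inter_add_ncard_sdiff_eq_ncard]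
    exact (pow_dvd_ncard_orbit_iff hQ a).mpr ha
  have hshort : orbit Q a \ A ⊆ {b | period x b < p ^ m} := by
    rintro b ⟨_, hb⟩
    simpa [A] using hb
  have hlt : (orbit Q a \ A).ncard < p ^ m := (Set.ncard_le_ncard hshort).trans_lt hm
  rw [← Set.sdiff_eq_empty, ← Set.ncard_eq_zero]
  exact Nat.eq_zero_of_dvd_of_lt hsdiff hlt

theorem normalizer_le_stabilizer_setOf_pow_le_period {Q : Subgroup G} (hQ : IsPGroup p Q)
    (hx : x ∈ Q) {m : ℕ} (hm : {a : α | period x a < p ^ m}.ncard < p ^ m) :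
    Subgroup.normalizer (Q : Set G) ≤ stabilizer G {a : α | p ^ m ≤ period x a} := by
  have hlong (a : α) : p ^ m ≤ period x a ↔ p ^ m ≤ (orbit Q a).ncard := by
    refine ⟨fun ha => ha.trans ?_, fun ha =>
      orbit_subset_setOf_pow_le_period hQ hx hm ha (mem_orbit_self a)⟩
    rw [← ncard_orbit_zpowers]
    exact Set.ncard_le_ncard <| orbit_subset_of_le_stabilizer
      ((Subgroup.zpowers_le.mpr hx).trans (le_stabilizer_orbit Q a)) (mem_orbit_self a)
  intro g hg
  refine mem_stabilizer_set.mpr fun a => ?_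
  rw [Set.mem_ofPred_eq, Set.mem_ofPred_eq, hlong, hlong, orbit_smul_of_mem_normalizer hg,
    Set.ncard_smul_set]

theorem subnormalizer_le_stabilizer_setOf_pow_le_period [Finite G]
    (hx : IsPGroup p (Subgroup.zpowers x)) {m : ℕ}
    (hm : {a : α | period x a < p ^ m}.ncard < p ^ m) :
    subnormalizer x ≤ stabilizer G {a : α | p ^ m ≤ period x a} :=
  subnormalizer_le hx fun _ hQ hxQ => normalizer_le_stabilizer_setOf_pow_le_period hQ hxQ hm

end Period

section CycleParts

open Equiv Equiv.Perm MulAction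
open scoped Pointwise

variable {α : Type*} [Fintype α] [DecidableEq α] {x : Perm α}

theorem period_eq_card_support {c : Perm α} (hc : c ∈ x.cycleFactorsFinset) {a : α}
    (ha : a ∈ c.support) : period x a = c.support.card := by
  obtain rfl := cycle_is_cycleOf ha hc
  refine Nat.dvd_right_iff_eq.mp fun k => ?_
  rw [← pow_smul_eq_iff_period_dvd]
  exact (isCycleOn_support_cycleOf x a).pow_apply_eq ha

theorem sum_comp_period {M : Type*} [AddCommMonoid M] (x : Perm α) (f : ℕ → M) :
    ∑ a : α, f (period x a) = (x.partition.parts.map fun l => l • f l).sum := by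
  have hsupp : x.support = x.cycleFactorsFinset.biUnion support := by
    conv_lhs => rw [← x.cycleFactorsFinset_noncommProd]
    exact support_noncommProd x.cycleFactorsFinset_pairwise_disjoint
  have hmoved : ∑ a ∈ x.support, f (period x a) = (x.cycleType.map fun l => l • f l).sum := by
    rw [hsupp, Finset.sum_biUnion fun c hc d hd h =>
      (x.cycleFactorsFinset_pairwise_disjoint hc hd h).disjoint_support, cycleType_def,
      Multiset.map_map]
    refine Finset.sum_congr rfl fun c hc => ?_
    rw [Finset.sum_congr rfl fun a ha => by rw [period_eq_card_support hc ha], Finset.sum_const]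
    rfl
  have hfixed : ∑ a ∈ x.supportᶜ, f (period x a) = (Fintype.card α - x.support.card) • f 1 := by
    rw [← Finset.card_compl, ← Finset.sum_const]
    refine Finset.sum_congr rfl fun a ha => ?_
    rw [period_eq_one_iff.mpr (by simpa using ha)]
  rw [← Finset.sum_add_sum_compl x.support, hmoved, hfixed, parts_partition, Multiset.map_add,
    Multiset.sum_add, Multiset.map_replicate, Multiset.sum_replicate, one_nsmul]

theorem ncard_setOf_period {ι : Type*} [Fintype ι] {k c : ι → ℕ}
    (hparts : x.partition.parts = ∑ i, Multiset.replicate (k i) (c i)) (q : ℕ → Prop)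
    [DecidablePred q] : {a : α | q (period x a)}.ncard = ∑ i with q (c i), k i * c i := by
  let F : Multiset ℕ →+ ℕ := Multiset.sumAddMonoidHom.comp
    (Multiset.mapAddMonoidHom fun l => l • if q l then 1 else 0)
  calc {a : α | q (period x a)}.ncard = ∑ a : α, if q (period x a) then 1 else 0 := by
        rw [← Finset.card_filter, ← Set.ncard_coe_finset]
        simp
    _ = F (∑ i, Multiset.replicate (k i) (c i)) := by
      rw [sum_comp_period x fun l => if q l then 1 else 0, hparts]; rfl
    _ = ∑ i with q (c i), k i * c i := by
      rw [map_sum, Finset.sum_filter]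
      simp [F]

theorem mem_support_longPart_iff {L : ℕ} (hL : 2 ≤ L) {a : α} :
    a ∈ (x.longPart L).support ↔ L ≤ period x a := by
  have hsupp : (x.longPart L).support =
      (x.cycleFactorsFinset.filter fun c => L ≤ c.support.card).biUnion support :=
    support_noncommProd fun c hc d hd h => x.cycleFactorsFinset_pairwise_disjoint
      (Finset.mem_filter.mp hc).1 (Finset.mem_filter.mp hd).1 h
  simp only [hsupp, Finset.mem_biUnion, Finset.mem_filter]
  constructor
  · rintro ⟨c, ⟨hc, hcL⟩, ha⟩
    rwa [period_eq_card_support hc ha]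
  · intro ha
    have hxa : x a ≠ a := fun h => by
      rw [period_eq_one_iff.mpr h] at ha
      omega
    have hc : x.cycleOf a ∈ x.cycleFactorsFinset :=
      cycleOf_mem_cycleFactorsFinset_iff.mpr (mem_support.mpr hxa)
    have hac : a ∈ (x.cycleOf a).support := (mem_support_cycleOf_iff' hxa).mpr (.refl x a)
    exact ⟨x.cycleOf a, ⟨hc, by rwa [← period_eq_card_support hc hac]⟩, hac⟩

theorem longPart_mul_shortPart (x : Perm α) (L : ℕ) : x.longPart L * x.shortPart L = x := by
  have hdisj := Finset.disjoint_filter_filter_not x.cycleFactorsFinset x.cycleFactorsFinset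
    fun c => L ≤ c.support.card
  have hunion := Finset.filter_union_filter_not_eq (fun c => L ≤ c.support.card)
    x.cycleFactorsFinset
  simp only [not_le] at hdisj hunion
  conv_rhs => rw [← x.cycleFactorsFinset_noncommProd]
  unfold longPart shortPart
  rw [← Finset.noncommProd_union_of_disjoint hdisj id]
  · exact Finset.noncommProd_congr hunion (fun _ _ => rfl) _
  · rw [hunion]
    exact x.cycleFactorsFinset_mem_commute

theorem subtypeCongrHom_longPart_shortPart (x : Perm α) (L : ℕ) :
    subtypeCongrHom (fun a => a ∈ (x.longPart L).support)
      (x.longPartOnSupport L, x.shortPartOnCompl L) = x := by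
  ext a
  conv_rhs => rw [← longPart_mul_shortPart x L]
  rw [subtypeCongrHom_apply]
  by_cases ha : a ∈ (x.longPart L).support
  · have hfix : x.shortPart L a = a :=
      (x.disjoint_longPart_shortPart L a).resolve_left (mem_support.mp ha)
    rw [Perm.subtypeCongr.left_apply _ _ ha, mul_apply, hfix]
    rfl
  · have hfix := (x.shortPart_apply_notMem_support_longPart_iff L a).mpr ha
    rw [Perm.subtypeCongr.right_apply _ _ ha, mul_apply, notMem_support.mp hfix]
    rfl

theorem range_subtypeCongrHom {β : Type*} (q : β → Prop) [DecidablePred q] :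
    (subtypeCongrHom q).range = stabilizer (Perm β) {b | q b} := by
  refine le_antisymm ?_ fun g hg => ?_
  · rintro _ ⟨⟨u, v⟩, rfl⟩
    refine mem_stabilizer_set.mpr fun b => ?_
    by_cases hb : q b
    · simp [Perm.subtypeCongr.left_apply _ _ hb, hb]
    · simpa [Perm.subtypeCongr.right_apply _ _ hb, hb] using (v ⟨b, hb⟩).2
  · have hq (b : β) : q (g b) ↔ q b := by
      simpa [smul_def] using mem_stabilizer_set.mp hg b
    refine ⟨(g.subtypePerm hq, g.subtypePerm fun b => not_congr (hq b)), ?_⟩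
    ext b
    rw [subtypeCongrHom_apply]
    by_cases hb : q b
    · rw [Perm.subtypeCongr.left_apply _ _ hb]
      rfl
    · rw [Perm.subtypeCongr.right_apply _ _ hb]
      rfl

theorem subnormalizer_eq_map_prod {p : ℕ} [Fact p.Prime] (hx : IsPGroup p (Subgroup.zpowers x))
    {m : ℕ} (hm : m ≠ 0) (hlt : {a : α | period x a < p ^ m}.ncard < p ^ m) :
    subnormalizer x =
      ((subnormalizer (x.longPartOnSupport (p ^ m))).prod
        (subnormalizer (x.shortPartOnCompl (p ^ m)))).map
        (subtypeCongrHom fun a => a ∈ (x.longPart (p ^ m)).support) := by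
  set y := x.longPartOnSupport (p ^ m)
  set z := x.shortPartOnCompl (p ^ m)
  set φ := subtypeCongrHom fun a => a ∈ (x.longPart (p ^ m)).support
  have hφ : Function.Injective φ := subtypeCongrHom_injective _
  have hφyz : φ (y, z) = x := subtypeCongrHom_longPart_shortPart x (p ^ m)
  have hyz : IsPGroup p (Subgroup.zpowers (y, z)) := by
    refine (hx.comap_of_injective φ hφ).to_le (Subgroup.zpowers_le.mpr ?_)
    rw [Subgroup.mem_comap, hφyz]
    exact Subgroup.mem_zpowers x
  have hy : IsPGroup p (Subgroup.zpowers y) :=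
    MonoidHom.map_zpowers (.fst _ _) (y, z) ▸ hyz.map (.fst _ _)
  have hz : IsPGroup p (Subgroup.zpowers z) :=
    MonoidHom.map_zpowers (.snd _ _) (y, z) ▸ hyz.map (.snd _ _)
  have htwo : 2 ≤ p ^ m := (Fact.out : p.Prime).two_le.trans (Nat.le_self_pow hm p)
  have hrange : φ.range = stabilizer (Perm α) {a : α | p ^ m ≤ period x a} := by
    simp only [φ, range_subtypeCongrHom, mem_support_longPart_iff htwo]
  rw [← subnormalizer_prod hy hz, map_subnormalizer hφ hyz, hφyz]
  intro Q hQ hxQ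
  rw [hφyz] at hxQ
  rw [hrange]
  exact normalizer_le_stabilizer_setOf_pow_le_period hQ hxQ hlt

end CycleParts

section Exchange

open MulAction
open scoped Pointwise

theorem exists_mem_subnormalizer_smul_eq {G β : Type*} [Group G] [Finite G] [MulAction G β] {p : ℕ}
    [Fact p.Prime] {x g : G} {S : Set β} (hx : IsPGroup p (Subgroup.zpowers x))
    (hxS : ∀ s ∈ S, x • s = s) (hg : g • S = S) :
    ∃ h ∈ subnormalizer x, ∀ s ∈ S, h • s = g • s := by
  have hnorm : g ∈ Subgroup.normalizer (fixingSubgroup G S : Set G) := by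
    rw [Subgroup.mem_normalizer_iff_map_conj_eq]
    exact SubMulAction.fixingSubgroup_map_conj_eq hg
  obtain ⟨h, hh, k, hk, rfl⟩ :=
    exists_mem_subnormalizer_mul_eq hx ((mem_fixingSubgroup_iff G).mpr hxS) hnorm
  exact ⟨h, hh, fun s hs => by rw [mul_smul, (mem_fixingSubgroup_iff G).mp hk s hs]⟩

variable {α : Type*} {C D : Set α}

theorem exists_perm_exchanging [Finite α] (hCD : Disjoint C D) (hcard : C.ncard = D.ncard) :
    ∃ τ : Equiv.Perm α, τ • C = D ∧ τ • D = C ∧ ∀ a ∉ C ∪ D, τ a = a := by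
  obtain ⟨f⟩ : Nonempty (C ≃ D) := by
    rwa [← Finite.card_eq, Nat.card_coe_set_eq, Nat.card_coe_set_eq]
  let ι : C ⊕ D ↪ α := .sumSet hCD
  let σ : Equiv.Perm (C ⊕ D) := (Equiv.sumComm C D).trans (Equiv.sumCongr f.symm f)
  let τ : Equiv.Perm α := σ.viaEmbedding ι
  have hC (c : C) : τ c = f c := Equiv.Perm.viaEmbedding_apply σ ι (.inl c)
  have hD (d : D) : τ d = f.symm d := Equiv.Perm.viaEmbedding_apply σ ι (.inr d)
  have hτC : τ • C ⊆ D := by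
    rintro _ ⟨c, hc, rfl⟩
    exact Set.mem_of_eq_of_mem (hC ⟨c, hc⟩) (f ⟨c, hc⟩).2
  have hτD : τ • D ⊆ C := by
    rintro _ ⟨d, hd, rfl⟩
    exact Set.mem_of_eq_of_mem (hD ⟨d, hd⟩) (f.symm ⟨d, hd⟩).2
  refine ⟨τ, Set.eq_of_subset_of_ncard_le hτC ?_, Set.eq_of_subset_of_ncard_le hτD ?_, ?_⟩
  · rw [Set.ncard_smul_set, hcard]
  · rw [Set.ncard_smul_set, hcard]
  · exact fun a ha => Equiv.Perm.viaEmbedding_apply_of_notMem σ ι a (by simpa [ι] using ha)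

theorem exists_mem_subnormalizer_exchanging [Finite α] {p : ℕ} [Fact p.Prime]
    {x : Equiv.Perm α} {E : Set α} (hx : IsPGroup p (Subgroup.zpowers x)) (hxC : x • C = C)
    (hxD : x • D = D) (hxE : x • E = E) (hCD : Disjoint C D) (hE : Disjoint E (C ∪ D))
    (hcard : C.ncard = D.ncard) : ∃ τ ∈ subnormalizer x, τ • C = D ∧ τ • E = E := by
  obtain ⟨τ, hτC, hτD, hτ⟩ := exists_perm_exchanging hCD hcard
  have hτE : τ • E = E :=
    (Set.image_congr fun a ha => hτ a (Set.disjoint_left.mp hE ha)).trans (Set.image_id E)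
  -- The Frattini argument is applied to the action on `Set α`, to the family `{C, D, E}`.
  have hτS : τ • ({C, D, E} : Set (Set α)) = {C, D, E} := by
    rw [Set.smul_set_insert, Set.smul_set_insert, Set.smul_set_singleton, hτC, hτD, hτE,
      Set.insert_comm]
  obtain ⟨h, hh, hhS⟩ := exists_mem_subnormalizer_smul_eq hx (S := {C, D, E})
    (by simp [hxC, hxD, hxE]) hτS
  exact ⟨h, hh, by rw [hhS C (by simp), hτC], by rw [hhS E (by simp), hτE]⟩

end Exchange

section Swaps

open Equiv MulAction
open scoped Pointwise

variable {α : Type*} [DecidableEq α] {U : Subgroup (Perm α)} {A B C D : Set α}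

/-- The subgroup `U` contains all transpositions of points of `A`; in the finite case this says that
`U` contains the symmetric group on `A`. -/
def ContainsSwaps (U : Subgroup (Perm α)) (A : Set α) : Prop :=
  ∀ a ∈ A, ∀ b ∈ A, swap a b ∈ U

theorem ContainsSwaps.mono (hB : ContainsSwaps U B) (h : A ⊆ B) : ContainsSwaps U A :=
  fun a ha b hb => hB a (h ha) b (h hb)

theorem containsSwaps_of_forall_swap_mem {c : α} (h : ∀ a ∈ A, swap c a ∈ U) :
    ContainsSwaps U A := fun a ha b hb =>
  SubmonoidClass.swap_mem_trans U (swap_comm c a ▸ h a ha) (h b hb)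

theorem ContainsSwaps.union (hA : ContainsSwaps U A) (hB : ContainsSwaps U B)
    (h : (A ∩ B).Nonempty) : ContainsSwaps U (A ∪ B) := by
  obtain ⟨c, hcA, hcB⟩ := h
  exact containsSwaps_of_forall_swap_mem fun a ha => ha.elim (hA c hcA a) (hB c hcB a)

theorem ContainsSwaps.of_smul {τ : Perm α} (hτ : τ ∈ U) (hA : ContainsSwaps U (τ • A)) :
    ContainsSwaps U A := fun a ha b hb => by
  have hab := hA (τ • a) (Set.smul_mem_smul_set ha) (τ • b) (Set.smul_mem_smul_set hb)
  rw [Perm.smul_def, Perm.smul_def, swap_apply_apply] at hab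
  rwa [U.mul_mem_cancel_right (U.inv_mem hτ), U.mul_mem_cancel_left hτ] at hab

theorem ContainsSwaps.eq_top [Finite α] (h : ContainsSwaps U Set.univ) : U = ⊤ := by
  rw [eq_top_iff, ← Perm.closure_isSwap, Subgroup.closure_le]
  rintro _ ⟨a, b, -, rfl⟩
  exact h a trivial b trivial

theorem ContainsSwaps.extend [Finite α] {p : ℕ} [Fact p.Prime] {x : Perm α}
    (hx : IsPGroup p (Subgroup.zpowers x)) (hA : ContainsSwaps (subnormalizer x) A)
    (hxA : x • A = A) (hxC : x • C = C) (hxD : x • D = D) (hCA : Disjoint C A) (hDA : D ⊂ A)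
    (hcard : C.ncard = D.ncard) : ContainsSwaps (subnormalizer x) (C ∪ A) := by
  obtain ⟨τ, hτ, hτC, hτE⟩ := exists_mem_subnormalizer_exchanging hx (E := A \ D) hxC hxD
    (by rw [Set.smul_set_sdiff, hxA, hxD]) (hCA.mono_right hDA.subset)
    (Set.disjoint_union_right.mpr ⟨hCA.symm.mono_left Set.sdiff_subset, Set.disjoint_sdiff_left⟩)
    hcard
  have hCE : ContainsSwaps (subnormalizer x) (C ∪ A \ D) := by
    refine .of_smul hτ ?_
    rwa [Set.smul_set_union, hτC, hτE, Set.union_sdiff_cancel hDA.subset]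
  obtain ⟨e, heA, heD⟩ := Set.exists_of_ssubset hDA
  refine (hCE.union hA ⟨e, .inr ⟨heA, heD⟩, heA⟩).mono ?_
  exact Set.union_subset_union_left A Set.subset_union_left

theorem swap_mem_subnormalizer [Finite α] {x : Perm α} (hx : IsPGroup 2 (Subgroup.zpowers x))
    {a b : α} (hper : period x a = period x b) (hab : b ∉ orbit (Subgroup.zpowers x) a) :
    swap a b ∈ subnormalizer x := by
  refine mem_subnormalizer_of_commute_conj hx (k := 1) (by simp [sq]) fun i => ?_
  rw [← swap_apply_apply]
  by_cases ha : (x ^ i) a = a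
  · have hb : (x ^ i) b = b := by
      rwa [← Perm.smul_def, zpow_smul_eq_iff_period_dvd, hper, ← zpow_smul_eq_iff_period_dvd] at ha
    rw [ha, hb]
    exact Commute.refl _
  · have hb : (x ^ i) b ≠ b := by
      rwa [ne_eq, ← Perm.smul_def, zpow_smul_eq_iff_period_dvd, ← hper,
        ← zpow_smul_eq_iff_period_dvd]
    have horbit (j : ℤ) : (x ^ j) a ≠ b := fun h => hab ⟨⟨x ^ j, j, rfl⟩, h⟩
    have hab' : a ≠ b := horbit 0
    have hba : a ≠ (x ^ i) b := fun h => horbit (-i) (by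
      rw [zpow_neg, Perm.inv_eq_iff_eq, h])
    exact (Perm.disjoint_swap_swap (by
      simp [hab', Ne.symm ha, Ne.symm hb, hba, (horbit i).symm])).commute

end Swaps

section CycleLengths

open Equiv MulAction
open scoped Pointwise

variable {α : Type*} [Finite α] [DecidableEq α] {p : ℕ} [Fact p.Prime] {x : Perm α} {A : Set α}

theorem containsSwaps_setOf_period_eq_or_ncard_eq (hx : IsPGroup 2 (Subgroup.zpowers x)) (l : ℕ) :
    ContainsSwaps (subnormalizer x) {a | period x a = l} ∨ {a : α | period x a = l}.ncard = l := by
  refine or_iff_not_imp_right.mpr fun hcard => ?_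
  intro a ha b hb
  have hsub := orbit_zpowers_subset_setOf_period_eq ha
  obtain ⟨c, hc, hca⟩ : ∃ c, period x c = l ∧ c ∉ orbit (Subgroup.zpowers x) a := by
    by_contra! hall
    exact hcard (by rw [← hsub.antisymm hall, ncard_orbit_zpowers, ha])
  by_cases hba : b ∈ orbit (Subgroup.zpowers x) a
  · have hcb : c ∉ orbit (Subgroup.zpowers x) b := orbit_eq_iff.mpr hba ▸ hca
    exact SubmonoidClass.swap_mem_trans _ (swap_mem_subnormalizer hx (ha.trans hc.symm) hca)
      (swap_comm b c ▸ swap_mem_subnormalizer hx (hb.trans hc.symm) hcb)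
  · exact swap_mem_subnormalizer hx (ha.trans hb.symm) hba

theorem containsSwaps_union_of_lt_ncard (hx : IsPGroup p (Subgroup.zpowers x))
    (hA : ContainsSwaps (subnormalizer x) A) (hxA : Subgroup.zpowers x ≤ stabilizer (Perm α) A)
    {l : ℕ} (hdvd : ∀ a ∈ A, period x a ∣ l) (hl : l < A.ncard)
    (hdisj : Disjoint A {a | period x a = l}) :
    ContainsSwaps (subnormalizer x) (A ∪ {a | period x a = l}) := by
  obtain ⟨B, hBA, hxB, hB⟩ := exists_subset_ncard_eq_of_forall_dvd hx hxA
    (fun a ha => ncard_orbit_zpowers x a ▸ hdvd a ha) hl.le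
  have hBA' : B ⊂ A := hBA.ssubset_of_ne fun h => hl.ne' (h ▸ hB)
  obtain ⟨c, hc⟩ := Set.nonempty_of_ncard_ne_zero (Nat.ne_zero_of_lt hl)
  refine containsSwaps_of_forall_swap_mem (c := c) fun e he => he.elim (hA c hc e) fun he => ?_
  have hext : ContainsSwaps (subnormalizer x) (orbit (Subgroup.zpowers x) e ∪ A) :=
    hA.extend hx (Subgroup.zpowers_le.mp hxA)
      (Subgroup.zpowers_le.mp (le_stabilizer_orbit _ e)) (Subgroup.zpowers_le.mp hxB)
      (hdisj.symm.mono_left (orbit_zpowers_subset_setOf_period_eq he)) hBA'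
      (by rw [ncard_orbit_zpowers, hB, he])
  exact hext c (.inr hc) e (.inl (mem_orbit_self e))

theorem containsSwaps_union_of_ncard_eq (hx : IsPGroup p (Subgroup.zpowers x)) {l : ℕ}
    (hl : ContainsSwaps (subnormalizer x) {a | period x a = l})
    (hne : {a : α | period x a = l}.Nonempty) (hcard : {a : α | period x a = l}.ncard ≠ l)
    (hxA : Subgroup.zpowers x ≤ stabilizer (Perm α) A) (hA : A.ncard = l)
    (hdisj : Disjoint A {a | period x a = l}) :
    ContainsSwaps (subnormalizer x) (A ∪ {a | period x a = l}) := by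
  obtain ⟨e, he⟩ := hne
  have horbit : (orbit (Subgroup.zpowers x) e).ncard = l := by rw [ncard_orbit_zpowers, he]
  have hsub : orbit (Subgroup.zpowers x) e ⊂ {a | period x a = l} :=
    (orbit_zpowers_subset_setOf_period_eq he).ssubset_of_ne fun h => hcard (h ▸ horbit)
  exact hl.extend hx (Subgroup.zpowers_le.mp (le_stabilizer_setOf_period x (· = l)))
    (Subgroup.zpowers_le.mp hxA) (Subgroup.zpowers_le.mp (le_stabilizer_orbit _ e)) hdisj hsub
    (by rw [hA, horbit])

theorem containsSwaps_setOf_period_lt_pow_succ (hx : IsPGroup p (Subgroup.zpowers x)) {k : ℕ}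
    (hk : p ^ k < {a : α | period x a < p ^ k}.ncard)
    (hS : ContainsSwaps (subnormalizer x) {a | period x a < p ^ k}) :
    ContainsSwaps (subnormalizer x) {a | period x a < p ^ (k + 1)} := by
  rw [setOf_period_lt_pow_succ hx]
  refine containsSwaps_union_of_lt_ncard hx hS (le_stabilizer_setOf_period x (· < p ^ k)) ?_ hk
    (disjoint_setOf_period_lt_setOf_period_eq x _)
  intro a ha
  obtain ⟨j, hj⟩ := exists_period_eq_pow hx a
  rw [hj]
  exact pow_dvd_pow p (Nat.pow_lt_pow_iff_right (Fact.out : p.Prime).one_lt |>.mp (hj ▸ ha)).le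

theorem containsSwaps_setOf_period_lt_pow_succ_or_ncard_eq
    (hx : IsPGroup 2 (Subgroup.zpowers x)) {k : ℕ}
    (hk : {a : α | period x a < 2 ^ k}.ncard = 2 ^ k) :
    ContainsSwaps (subnormalizer x) {a | period x a < 2 ^ (k + 1)} ∨
      {a : α | period x a < 2 ^ (k + 1)}.ncard = 2 ^ k ∨
      {a : α | period x a < 2 ^ (k + 1)}.ncard = 2 ^ (k + 1) := by
  have hdisj := disjoint_setOf_period_lt_setOf_period_eq (α := α) x (2 ^ k)
  rw [setOf_period_lt_pow_succ hx, Set.ncard_union_eq hdisj, hk]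
  obtain hempty | hne := Set.eq_empty_or_nonempty {a : α | period x a = 2 ^ k}
  · simp [hempty]
  by_cases hcard : {a : α | period x a = 2 ^ k}.ncard = 2 ^ k
  · exact .inr (.inr (by rw [hcard]; ring))
  · exact .inl (containsSwaps_union_of_ncard_eq hx
      ((containsSwaps_setOf_period_eq_or_ncard_eq hx _).resolve_right hcard) hne hcard
      (le_stabilizer_setOf_period x (· < 2 ^ k)) hk hdisj)

theorem containsSwaps_setOf_period_lt_or_ncard_eq (hx : IsPGroup 2 (Subgroup.zpowers x))
    (H : ∀ a b : α, period x b < period x a →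
      period x a ≤ {c : α | period x c < period x a}.ncard) (k : ℕ) :
    ContainsSwaps (subnormalizer x) {a | period x a < 2 ^ k} ∨
      ∃ j ≤ k, {a : α | period x a < 2 ^ k}.ncard = 2 ^ j := by
  induction k with
  | zero =>
    refine .inl fun a ha => ?_
    exact absurd (Nat.lt_one_iff.mp ha) (period_pos_of_orderOf_pos (orderOf_pos x) a).ne'
  | succ k ih =>
    have hunion := setOf_period_lt_pow_succ (α := α) hx k
    obtain hM | ⟨e, he⟩ := Set.eq_empty_or_nonempty {a : α | period x a = 2 ^ k}
    · rw [hunion, hM, Set.union_empty]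
      exact ih.imp_right fun ⟨j, hj, h⟩ => ⟨j, hj.trans k.le_succ, h⟩
    obtain hS | ⟨b, hb⟩ := Set.eq_empty_or_nonempty {a : α | period x a < 2 ^ k}
    · rw [hunion, hS, Set.empty_union]
      exact (containsSwaps_setOf_period_eq_or_ncard_eq hx _).imp_right
        fun h => ⟨k, k.le_succ, h⟩
    have hle : 2 ^ k ≤ {a : α | period x a < 2 ^ k}.ncard := by
      simpa only [he.out] using H e b (hb.out.trans_eq he.out.symm)
    obtain heq | hlt := hle.eq_or_lt
    · obtain h | h | h := containsSwaps_setOf_period_lt_pow_succ_or_ncard_eq hx heq.symm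
      · exact .inl h
      · exact .inr ⟨k, k.le_succ, h⟩
      · exact .inr ⟨k + 1, le_rfl, h⟩
    · have hnot : ¬ ∃ j ≤ k, {a : α | period x a < 2 ^ k}.ncard = 2 ^ j := by
        rintro ⟨j, hj, h⟩
        exact (h ▸ hlt).not_ge (Nat.pow_le_pow_right two_pos hj)
      exact .inl (containsSwaps_setOf_period_lt_pow_succ hx hlt (ih.resolve_right hnot))

omit [DecidableEq α] in
theorem subnormalizer_eq_top (hx : IsPGroup 2 (Subgroup.zpowers x))
    (hcard : ¬ ∃ a, Nat.card α = 2 ^ a)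
    (H : ∀ a b : α, period x b < period x a →
      period x a ≤ {c : α | period x c < period x a}.ncard) : subnormalizer x = ⊤ := by
  classical
  have huniv : {a : α | period x a < 2 ^ Nat.card α} = Set.univ := Set.eq_univ_of_forall fun a => by
    rw [Set.mem_ofPred_eq, ← ncard_orbit_zpowers]
    exact (Set.ncard_le_card _).trans_lt Nat.lt_two_pow_self
  obtain h | ⟨j, -, h⟩ := containsSwaps_setOf_period_lt_or_ncard_eq hx H (Nat.card α)
  · exact ContainsSwaps.eq_top (huniv ▸ h)
  · rw [huniv, Set.ncard_univ] at h
    exact absurd ⟨j, h⟩ hcard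

end CycleLengths

section CycleType

open Equiv MulAction

variable {α ι : Type*} [Fintype α] [DecidableEq α] [Fintype ι] {x : Perm α} {k c : ι → ℕ}

theorem range_period (hk : ∀ i, 1 ≤ k i)
    (hparts : x.partition.parts = ∑ i, Multiset.replicate (k i) (c i)) :
    (Set.range fun a : α => period x a) = Set.range c := by
  have hc (i : ι) : 0 < c i := by
    refine x.partition.parts_pos (hparts ▸ Multiset.mem_sum.mpr ⟨i, Finset.mem_univ i, ?_⟩)
    exact Multiset.mem_replicate.mpr ⟨Nat.ne_zero_of_lt (hk i), rfl⟩
  ext l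
  calc (∃ a : α, period x a = l) ↔ 0 < {a : α | period x a = l}.ncard :=
        (Set.ncard_pos (Set.toFinite _)).symm
    _ ↔ ∃ i, c i = l := by
      rw [ncard_setOf_period hparts (· = l), Finset.sum_pos_iff]
      simp [Nat.zero_lt_of_lt (hk _), hc]

variable [LinearOrder ι]

theorem ncard_setOf_period_lt [LocallyFiniteOrderBot ι] (hc : StrictMono c)
    (hparts : x.partition.parts = ∑ i, Multiset.replicate (k i) (c i)) (i : ι) :
    {a : α | period x a < c i}.ncard = ∑ j ∈ Finset.Iio i, k j * c j := by
  rw [ncard_setOf_period hparts (· < c i)]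
  simp only [hc.lt_iff_lt, Finset.filter_gt_eq_Iio]

theorem card_support_longPart [LocallyFiniteOrderTop ι] (hc : StrictMono c)
    (hparts : x.partition.parts = ∑ i, Multiset.replicate (k i) (c i)) {i : ι} (hi : 2 ≤ c i) :
    (x.longPart (c i)).support.card = ∑ j ∈ Finset.Ici i, k j * c j := by
  have hsupp : ((x.longPart (c i)).support : Set α) = {a | c i ≤ period x a} :=
    Set.ext fun _ => mem_support_longPart_iff hi
  rw [← Set.ncard_coe_finset, hsupp, ncard_setOf_period hparts (c i ≤ ·)]
  simp only [hc.le_iff_le, Finset.filter_le_eq_Ici]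

end CycleType

theorem mainTheorem4_general {α : Type*} [Fintype α] [DecidableEq α]
    (hn : ¬ ∃ a : ℕ, Fintype.card α = 2 ^ a) (x : Equiv.Perm α) (hx : ∃ a : ℕ, orderOf x = 2 ^ a)
    (r : ℕ) (m ℓ : Fin r → ℕ) (hm : StrictMono m) (hℓ : ∀ i, 1 ≤ ℓ i)
    (hcycles : x.partition.parts = ∑ i, Multiset.replicate (ℓ i) (2 ^ m i)) :
    (subnormalizer x < ⊤ ↔
      ∃ t : Fin r, 0 < t.val ∧ ∑ i ∈ Finset.Iio t, ℓ i * 2 ^ m i < 2 ^ m t) ∧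
    ∀ t : Fin r, 0 < t.val → ∑ i ∈ Finset.Iio t, ℓ i * 2 ^ m i < 2 ^ m t →
      (x.longPart (2 ^ m t)).support.card = ∑ i ∈ Finset.Ici t, ℓ i * 2 ^ m i ∧
      subnormalizer x =
        ((subnormalizer (x.longPartOnSupport (2 ^ m t))).prod
          (subnormalizer (x.shortPartOnCompl (2 ^ m t)))).map
          (Equiv.Perm.subtypeCongrHom fun a => a ∈ (x.longPart (2 ^ m t)).support) := by
  have hx' : IsPGroup 2 (Subgroup.zpowers x) :=
    hx.elim fun a ha => .of_card (n := a) (by rw [Nat.card_zpowers, ha])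
  have hpow : StrictMono fun i => 2 ^ m i := (pow_right_strictMono₀ one_lt_two).comp hm
  have hshort := ncard_setOf_period_lt hpow hcycles
  have hrange := range_period hℓ hcycles
  have hmt (t : Fin r) (ht : 0 < t.val) : m t ≠ 0 :=
    Nat.ne_zero_of_lt (hm (show ⟨0, ht.trans t.2⟩ < t from ht))
  refine ⟨⟨fun hlt => ?_, fun ⟨t, ht, hlt⟩ => ?_⟩, fun t ht hlt =>
    ⟨card_support_longPart hpow hcycles (Nat.le_self_pow (hmt t ht) 2),
      subnormalizer_eq_map_prod hx' (hmt t ht) ((hshort t).trans_lt hlt)⟩⟩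
  · by_contra! hno
    refine hlt.ne (subnormalizer_eq_top hx' (by rwa [Nat.card_eq_fintype_card]) fun a b hab => ?_)
    obtain ⟨t, ht⟩ := hrange.subset ⟨a, rfl⟩
    obtain ⟨s, hs⟩ := hrange.subset ⟨b, rfl⟩
    simp only [← ht, ← hs] at hab ⊢
    exact (hno t (Nat.zero_lt_of_lt (hpow.lt_iff_lt.mp hab))).trans_eq (hshort t).symm
  · obtain ⟨a, ha⟩ := hrange.superset ⟨t, rfl⟩
    obtain ⟨b, hb⟩ := hrange.superset ⟨⟨0, ht.trans t.2⟩, rfl⟩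
    refine (subnormalizer_le_stabilizer_setOf_pow_le_period (α := α) hx'
      ((hshort t).trans_lt hlt)).trans_lt (lt_top_iff_ne_top.mpr ?_)
    refine Equiv.Perm.stabilizer_ne_top_of_nonempty_of_nonempty_compl ⟨a, ha.ge⟩ ⟨b, ?_⟩
    exact (hb.trans_lt (hpow ht)).not_ge

/-- The multiset `x.partition.parts` consists of the lengths of all cycles of `x`, fixed points
being cycles of length `1`. The index `t` is counted from `0`, so `0 < t` excludes the shortest
cycle length. `Equiv.Perm.subtypeCongrHom` is the natural embedding
`Sym(Ω) × Sym(Ωᶜ) → Sym(Fin n)`. -/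
theorem mainTheorem4 (n : ℕ) (hn : ¬ ∃ a : ℕ, n = 2 ^ a)
    (x : Equiv.Perm (Fin n)) (hx : ∃ a : ℕ, orderOf x = 2 ^ a)
    (r : ℕ) (m ℓ : Fin r → ℕ) (hm : StrictMono m) (hℓ : ∀ i, 1 ≤ ℓ i)
    (hcycles : x.partition.parts = ∑ i, Multiset.replicate (ℓ i) (2 ^ m i)) :
    (subnormalizer x < ⊤ ↔
      ∃ t : Fin r, 0 < t.val ∧ ∑ i ∈ Finset.Iio t, ℓ i * 2 ^ m i < 2 ^ m t) ∧
    ∀ t : Fin r, 0 < t.val → ∑ i ∈ Finset.Iio t, ℓ i * 2 ^ m i < 2 ^ m t →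
      (x.longPart (2 ^ m t)).support.card = ∑ i ∈ Finset.Ici t, ℓ i * 2 ^ m i ∧
      subnormalizer x =
        ((subnormalizer (x.longPartOnSupport (2 ^ m t))).prod
          (subnormalizer (x.shortPartOnCompl (2 ^ m t)))).map
          (Equiv.Perm.subtypeCongrHom fun a => a ∈ (x.longPart (2 ^ m t)).support) :=
  mainTheorem4_general (by simpa using hn) x hx r m ℓ hm hℓ hcycles
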